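/- **Theorem 4.5.** Let $\alpha>-1$ and $\theta>0$ be real. For $N\ge 0$ let the $N$-point biorthogonal Laguerre ensemble be the ensemble on $(0,\infty)^N$ with joint probability density $$p_N(x_1,\dots,x_N)=\frac1{Z_N}\prod_{i<j}\bigl[(x_i-x_j)(x_i^{\theta}-x_j^{\theta})\bigr]\prod_{i=1}^N x_i^{\alpha}e^{-x_i},$$ where $Z_N$ is the normalising constant, i.e. the integral of the unnormalised density over $(0,\infty)^N$, and let its $n$-point correlation function be $$\rho_{n,N}(x_1,\dots,x_n)=\frac{N!}{(N-n)!}\int_{(0,\infty)^{N-n}}p_N(x_1,\dots,x_N)\,dx_{n+1}\cdots dx_N\qquad(1\le n\le N).$$ These objects are well defined: the integral $Z_N$ converges and is positive, and the integrals defining $\rho_{n,N}$ converge for all $x_1,\dots,x_n>0$. For $x,y>0$ let $$\mathcal K^{(\alpha,\theta)}(x,y)=\sum_{k,l=0}^{\infty}\frac{(-1)^kx^k}{k!\,\Gamma\bigl(\frac{\alpha+1+k}{\theta}\bigr)}\,\frac{(-1)^l y^{\theta l}}{l!\,\Gamma(\alpha+1+\theta l)}\,\frac{\theta}{\alpha+1+k+\theta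 l}.$$ This double series converges absolutely, and $$\mathcal K^{(\alpha,\theta)}(x,y)=\theta\int_0^1 J_{\frac{\alpha+1}{\theta},\frac1\theta}(xt)\,J_{\alpha+1,\theta}\bigl((yt)^{\theta}\bigr)\,t^{\alpha}\,dt,\qquad J_{a,b}(s)=\sum_{m=0}^{\infty}\frac{(-s)^m}{m!\,\Gamma(a+bm)},$$ where the integral and, for all real $s$, the series for $J_{\frac{\alpha+1}{\theta},\frac1\theta}(s)$ and $J_{\alpha+1,\theta}(s)$ converge absolutely. Then for every $n=1,2,\dots$ and all $x_1,\dots,x_n>0$ the following limit exists and has the stated value: $$\lim_{N\to\infty}\frac1{N^{n/\theta}}\,\rho_{n,N}\Bigl(\frac{x_1}{N^{1/\theta}},\dots,\frac{x_n}{N^{1/\theta}}\Bigr)=\prod_{i=1}^n x_i^{\alpha}\cdot\det\bigl[\mathcal K^{(\alpha,\theta)}(x_i,x_j)\bigr]_{i,j=1}^n .$$ -/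

import Mathlib

open MeasureTheory Filter Topology

noncomputable section

/-- The open orthant `(0, ∞) ^ m`. -/
def posOrthant (m : ℕ) : Set (Fin m → ℝ) :=
  Set.univ.pi fun _ => Set.Ioi (0 : ℝ)

/-- The unnormalised joint density of the `N`-point biorthogonal Laguerre ensemble,
`∏_{i<j} (x_i - x_j) (x_i ^ θ - x_j ^ θ) * ∏_i x_i ^ α * e ^ (-x_i)`, for `x` in `(0, ∞) ^ N`. -/
def laguerreWeight (α θ : ℝ) (N : ℕ) (x : Fin N → ℝ) : ℝ :=
  (∏ i, ∏ j ∈ Finset.Ioi i, (x i - x j) * (x i ^ θ - x j ^ θ)) *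
    ∏ i, x i ^ α * Real.exp (-x i)

/-- The normalisation integral of `laguerreWeight` over `(0, ∞) ^ N`. -/
def laguerreZ (α θ : ℝ) (N : ℕ) : ℝ :=
  ∫ x in posOrthant N, laguerreWeight α θ N x

/-- The joint probability density of the `N`-point biorthogonal Laguerre ensemble on
`(0, ∞) ^ N`. -/
def laguerreDensity (α θ : ℝ) (N : ℕ) (x : Fin N → ℝ) : ℝ :=
  (laguerreZ α θ N)⁻¹ * laguerreWeight α θ N x

/-- The `N`-tuple whose first `n` entries are those of `x` and whose other `N - n` entries are
those of `y` (for `n ≤ N`). -/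
def joinPoints {n N : ℕ} (x : Fin n → ℝ) (y : Fin (N - n) → ℝ) : Fin N → ℝ := fun i =>
  if h : (i : ℕ) < n then x ⟨i, h⟩ else y ⟨(i : ℕ) - n, by omega⟩

/-- The `n`-point correlation function of the `N`-point biorthogonal Laguerre ensemble,
`N! / (N - n)! * ∫ p(x_1, …, x_N) dx_{n+1} ⋯ dx_N`, the integral being over `(0, ∞) ^ (N - n)`.
Here `N.descFactorial n` is `N! / (N - n)!` if `n ≤ N`, and it is `0` if `n > N`. -/
def laguerreCorrelation (α θ : ℝ) (n N : ℕ) (x : Fin n → ℝ) : ℝ :=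
  (N.descFactorial n : ℝ) *
    ∫ y in posOrthant (N - n), laguerreDensity α θ N (joinPoints x y)

/-- The terms of the double series that defines the limit kernel, indexed by `(k, l)`. -/
def limitKernelTerm (α θ x y : ℝ) (p : ℕ × ℕ) : ℝ :=
  ((-1) ^ p.1 * x ^ p.1 / (p.1.factorial * Real.Gamma ((α + 1 + p.1) / θ))) *
    ((-1) ^ p.2 * y ^ (θ * p.2) / (p.2.factorial * Real.Gamma (α + 1 + θ * p.2))) *
    (θ / (α + 1 + p.1 + θ * p.2))

/-- The limit kernel `𝒦^{(α,θ)}(x, y)`, as a double series. -/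
def limitKernel (α θ x y : ℝ) : ℝ :=
  ∑' p : ℕ × ℕ, limitKernelTerm α θ x y p

/-- The terms of Wright's generalised Bessel series. -/
def wrightTerm (a b x : ℝ) (m : ℕ) : ℝ :=
  (-x) ^ m / (m.factorial * Real.Gamma (a + b * m))

/-- Wright's generalised Bessel function `J_{a,b}(x) = ∑_m (-x) ^ m / (m! Γ(a + b m))`. -/
def wrightJ (a b x : ℝ) : ℝ :=
  ∑' m : ℕ, wrightTerm a b x m

/-- The integrand `J_{(α+1)/θ, 1/θ}(x t) J_{α+1, θ}((y t) ^ θ) t ^ α` of the integral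
representation of the limit kernel. -/
def wrightIntegrand (α θ x y t : ℝ) : ℝ :=
  wrightJ ((α + 1) / θ) (1 / θ) (x * t) * wrightJ (α + 1) θ ((y * t) ^ θ) * t ^ α

end

/-! The density is a product of two Vandermonde determinants, in `x` and in `x ^ θ`, times a weight.
It is therefore proportional to `det [K_N(x_i, x_j)]` for any kernel `K_N(x, y) = ∑ l, f_l(x)
g_l(y)` with `g_l(y) = y ^ (θ l)` and `f_l` equal to `x ^ α e ^ (-x)` times a polynomial of degree
below `N`, provided that the coefficient matrix is invertible. If the two families are
biorthonormal, `K_N` reproduces itself, variables can be integrated out one by one, and the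
correlation functions are determinants of `K_N` (`integral_kernelDet_sumElim`,
`laguerreCorrelation_eq_kernelDet`). Integrating out everything also shows that the normalising
constant is nonzero.

The `f_l` are explicit. By `exists_companion`, a polynomial `P` yields a polynomial `q` for which `e
^ (-x) q(x)` has Taylor coefficients `(-1) ^ s P(s) / s!` and Mellin transform `Γ(β) P(-β)`.
Biorthogonality only asks that `P` vanish at prescribed nodes, so `P` is a product of linear
factors.

The Taylor series turns the rescaled `K_N` into a double series whose terms are those of the limit
kernel times two factors tending to 1: a ratio of Gamma values and a falling factorial over a power.
The first is at most `1 + Γ(a + 1)` by `gammaRatio_le`, the second at most 1, and dominated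
convergence for series gives the limit. -/

noncomputable section

/-! ### Determinants of finite-rank kernels and integrating out variables -/

/-- The determinant of a matrix bordered by one row and one column. -/
theorem det_fromBlocks_border {κ : Type*} [Fintype κ] [DecidableEq κ] (A : Matrix κ κ ℝ)
    (b c : κ → ℝ) (d : ℝ) :
    (Matrix.fromBlocks A (Matrix.replicateCol Unit b) (Matrix.replicateRow Unit c)
      (Matrix.of fun _ _ : Unit => d)).det = d * A.det - c ⬝ᵥ (A.adjugate.mulVec b) := by
  -- The Schur complement formula needs an invertible block. `A + t • 1` is singular only at the
  -- finitely many roots of the characteristic polynomial of `-A`, and both sides are continuous in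
  -- `t`.
  let p : ℝ → Matrix κ κ ℝ := fun t => A + t • (1 : Matrix κ κ ℝ)
  have hp : Continuous p := by fun_prop
  have hfin : {t : ℝ | (p t).det = 0}.Finite := by
    have hne : (-A).charpoly ≠ 0 := (Matrix.charpoly_monic _).ne_zero
    refine ((-A).charpoly.roots.toFinset.finite_toSet).subset fun t ht => ?_
    have : (-A).charpoly.eval t = 0 := by
      rw [Matrix.eval_charpoly, ← ht.out]
      congr 1
      simp only [p, sub_neg_eq_add, Matrix.scalar_apply, Matrix.smul_one_eq_diagonal]
      exact add_comm _ _
    simpa [hne] using this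
  have key := Continuous.ext_on (hfin.countable.dense_compl ℝ)
    (f := fun t => (Matrix.fromBlocks (p t) (Matrix.replicateCol Unit b)
      (Matrix.replicateRow Unit c) (Matrix.of fun _ _ : Unit => d)).det)
    (g := fun t => d * (p t).det - c ⬝ᵥ ((p t).adjugate.mulVec b))
    (Continuous.matrix_det (hp.matrix_fromBlocks continuous_const continuous_const
      continuous_const)) (by fun_prop) ?_
  · simpa [p] using congrFun key 0
  · intro t ht
    have hu : IsUnit (p t).det := isUnit_iff_ne_zero.mpr ht
    have hi : Invertible (p t) := Matrix.invertibleOfIsUnitDet _ hu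
    have hr : ∀ M : Matrix Unit Unit ℝ, M.det = M () () := fun M => Matrix.det_unique M
    have hv : (p t).det * (c ⬝ᵥ ((p t)⁻¹.mulVec b)) = c ⬝ᵥ ((p t).adjugate.mulVec b) := by
      rw [Matrix.inv_def, Matrix.smul_mulVec, dotProduct_smul, smul_eq_mul, ← mul_assoc,
        Ring.mul_inverse_cancel _ hu, one_mul]
    simp only
    rw [Matrix.det_fromBlocks₁₁, hr, Matrix.invOf_eq_nonsing_inv, ← hv]
    have : (Matrix.replicateRow Unit c * (p t)⁻¹ * Matrix.replicateCol Unit b) () () =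
        c ⬝ᵥ ((p t)⁻¹.mulVec b) := by
      rw [Matrix.dotProduct_mulVec, Matrix.mul_apply']
      rfl
    simp only [Matrix.sub_apply, this, Matrix.of_apply]
    ring

section Determinantal

variable {X ι : Type*} [Fintype ι]

/-- The finite-rank kernel `∑ l, f l x * g l y`. -/
def finiteRankKernel (f g : ι → X → ℝ) (x y : X) : ℝ := ∑ l, f l x * g l y

/-- The determinant `det [K (z i) (z j)]` of the kernel `K = finiteRankKernel f g`. -/
def kernelDet (f g : ι → X → ℝ) {κ : Type*} [Fintype κ] [DecidableEq κ] (z : κ → X) : ℝ :=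
  (Matrix.of fun i j => finiteRankKernel f g (z i) (z j)).det

theorem kernelDet_comp_equiv (f g : ι → X → ℝ) {κ κ' : Type*} [Fintype κ] [DecidableEq κ]
    [Fintype κ'] [DecidableEq κ'] (e : κ' ≃ κ) (z : κ → X) :
    kernelDet f g (z ∘ e) = kernelDet f g z := by
  unfold kernelDet
  rw [← Matrix.det_submatrix_equiv_self e]
  rfl

/-- The Leibniz expansion is regrouped so that each variable `z i` occurs in exactly one product `f
* g`. The terms then separate, and only the products `f i * g j` have to be integrable. -/
theorem kernelDet_eq_sum (f g : ι → X → ℝ) {κ : Type*} [Fintype κ] [DecidableEq κ]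
    (z : κ → X) :
    kernelDet f g z = ∑ σ : Equiv.Perm κ, ∑ p : κ → ι,
      ((Equiv.Perm.sign σ : ℤ) : ℝ) * ∏ i, (f (p (σ⁻¹ i)) (z i) * g (p i) (z i)) := by
  classical
  unfold kernelDet
  rw [Matrix.det_apply']
  refine Finset.sum_congr rfl fun σ _ => ?_
  simp only [Matrix.of_apply, finiteRankKernel]
  rw [Finset.prod_univ_sum, Finset.mul_sum, Fintype.piFinset_univ]
  refine Finset.sum_congr rfl fun p _ => ?_
  rw [Finset.prod_mul_distrib, Finset.prod_mul_distrib,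
    ← Equiv.prod_comp σ (fun i => f (p (σ⁻¹ i)) (z i))]
  simp

variable [MeasurableSpace X] {μ : Measure X} {f g : ι → X → ℝ}

theorem integrable_kernelDet_sumElim [SigmaFinite μ]
    (hint : ∀ i j, Integrable (fun x => f i x * g j x) μ) {κ κ' : Type*} [Fintype κ]
    [DecidableEq κ] [Fintype κ'] [DecidableEq κ'] (x : κ → X) :
    Integrable (fun y : κ' → X => kernelDet f g (Sum.elim x y)) (Measure.pi fun _ => μ) := by
  simp only [kernelDet_eq_sum, Fintype.prod_sum_type, Sum.elim_inl, Sum.elim_inr]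
  refine integrable_finsetSum _ fun σ _ => integrable_finsetSum _ fun p _ => ?_
  refine Integrable.const_mul (Integrable.const_mul ?_ _) _
  exact Integrable.fintype_prod (f := fun i x => f (p (σ⁻¹ (Sum.inr i))) x * g (p (Sum.inr i)) x)
    fun i => hint _ _

variable [DecidableEq ι]

/-- Expand along the border. The corner `K a a` integrates to the rank `card ι`. By the reproducing
property `K (x i) a * K a (x j)` integrates to `K (x i) (x j)`, so after contraction with the
adjugate each index `j` subtracts one copy of the determinant. -/
theorem integral_kernelDet_sumElim_unit
    (hint : ∀ i j, Integrable (fun x => f i x * g j x) μ)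
    (horth : ∀ i j, ∫ x, f i x * g j x ∂μ = if i = j then 1 else 0) {κ : Type*} [Fintype κ]
    [DecidableEq κ] (x : κ → X) :
    ∫ a, kernelDet f g (Sum.elim x fun _ : Unit => a) ∂μ =
      ((Fintype.card ι : ℝ) - Fintype.card κ) * kernelDet f g x := by
  set K := finiteRankKernel f g with hK
  set A : Matrix κ κ ℝ := Matrix.of fun i j => K (x i) (x j) with hA
  obtain ⟨B, hB, hdet⟩ : ∃ B : κ → κ → ℝ, (∀ j, ∑ i, B j i * A i j = A.det) ∧
      ∀ a, kernelDet f g (Sum.elim x fun _ : Unit => a) =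
        K a a * A.det - ∑ j, ∑ i, B j i * (K a (x j) * K (x i) a) := by
    refine ⟨fun j i => A.adjugate j i, fun j => ?_, fun a => ?_⟩
    · rw [← Matrix.mul_apply, Matrix.adjugate_mul]
      simp
    have : (Matrix.of fun i j => K ((Sum.elim x fun _ : Unit => a) i)
        ((Sum.elim x fun _ : Unit => a) j)) =
        Matrix.fromBlocks A (Matrix.replicateCol Unit fun i => K (x i) a)
        (Matrix.replicateRow Unit fun j => K a (x j)) (Matrix.of fun _ _ : Unit => K a a) := by
      ext i j
      rcases i with i | i <;> rcases j with j | j <;> rfl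
    rw [kernelDet, ← hK, this, det_fromBlocks_border]
    congr 1
    simp only [dotProduct, Matrix.mulVec, Finset.mul_sum]
    exact Finset.sum_congr rfl fun j _ => Finset.sum_congr rfl fun i _ => by ring
  have hdiag : Integrable (fun a => K a a) μ := by
    simp only [hK, finiteRankKernel]
    exact integrable_finsetSum _ fun l _ => hint l l
  have hdiag' : ∫ a, K a a ∂μ = Fintype.card ι := by
    simp only [hK, finiteRankKernel]
    rw [integral_finsetSum _ fun l _ => hint l l]
    simp [horth]
  have hexp : ∀ i j a, K a (x j) * K (x i) a =
      ∑ l, ∑ m, g l (x j) * f m (x i) * (f l a * g m a) := by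
    intro i j a
    simp only [hK, finiteRankKernel, Finset.sum_mul_sum]
    exact Finset.sum_congr rfl fun _ _ => Finset.sum_congr rfl fun _ _ => by ring
  have hoff : ∀ i j, Integrable (fun a => K a (x j) * K (x i) a) μ := by
    intro i j
    simp only [hexp]
    exact integrable_finsetSum _ fun l _ => integrable_finsetSum _ fun m _ =>
      (hint l m).const_mul _
  have hoff' : ∀ i j, ∫ a, K a (x j) * K (x i) a ∂μ = A i j := by
    intro i j
    simp only [hexp]
    rw [integral_finsetSum _ fun l _ => integrable_finsetSum _ fun m _ =>
      (hint l m).const_mul _]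
    have : ∀ l, ∫ a, ∑ m, g l (x j) * f m (x i) * (f l a * g m a) ∂μ =
        f l (x i) * g l (x j) := by
      intro l
      rw [integral_finsetSum _ fun m _ => (hint l m).const_mul _]
      simp only [integral_const_mul, horth]
      simp [mul_comm]
    simp only [this]
    rfl
  simp only [hdet]
  rw [integral_sub (hdiag.mul_const _) (integrable_finsetSum _ fun j _ =>
      integrable_finsetSum _ fun i _ => (hoff i j).const_mul _), integral_mul_const, hdiag',
    integral_finsetSum _ fun j _ => integrable_finsetSum _ fun i _ => (hoff i j).const_mul _]
  have : ∀ j, ∫ a, ∑ i, B j i * (K a (x j) * K (x i) a) ∂μ = A.det := by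
    intro j
    rw [integral_finsetSum _ fun i _ => (hoff i j).const_mul _]
    simp only [integral_const_mul, hoff', hB]
  simp only [this, Finset.sum_const, Finset.card_univ, nsmul_eq_mul]
  have hA' : kernelDet f g x = A.det := rfl
  rw [hA']
  ring

/-- Integrating out `m` variables of the determinant of a reproducing kernel. -/
theorem integral_kernelDet_sumElim [SigmaFinite μ]
    (hint : ∀ i j, Integrable (fun x => f i x * g j x) μ)
    (horth : ∀ i j, ∫ x, f i x * g j x ∂μ = if i = j then 1 else 0) (m : ℕ) {κ : Type}
    [Fintype κ] [DecidableEq κ] (x : κ → X) :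
    ∫ y : Fin m → X, kernelDet f g (Sum.elim x y) ∂(Measure.pi fun _ => μ) =
      (∏ k ∈ Finset.range m, ((Fintype.card ι : ℝ) - Fintype.card κ - k)) * kernelDet f g x := by
  -- The coordinate that is split off joins the fixed points, so the induction hypothesis is used
  -- for `κ ⊕ Unit`.
  induction m generalizing κ with
  | zero =>
    have h : ∀ y : Fin 0 → X, kernelDet f g (Sum.elim x y) = kernelDet f g x := fun y => by
      rw [← kernelDet_comp_equiv f g (Equiv.sumEmpty κ (Fin 0)) x]
      congr 1
      ext i
      rcases i with i | i
      · rfl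
      · exact i.elim0
    simp only [h, integral_const, Finset.range_zero, Finset.prod_empty, one_mul]
    simp [measureReal_def]
  | succ m ih =>
    have hmp := (measurePreserving_piFinSuccAbove (fun _ : Fin (m + 1) => μ) 0).symm
    have hre : ∀ (a : X) (y : Fin m → X),
        kernelDet f g (Sum.elim x ((MeasurableEquiv.piFinSuccAbove (fun _ => X) 0).symm (a, y))) =
          kernelDet f g (Sum.elim (Sum.elim x fun _ : Unit => a) y) := by
      intro a y
      let e : (κ ⊕ Unit) ⊕ Fin m ≃ κ ⊕ Fin (m + 1) :=
        (Equiv.sumAssoc κ Unit (Fin m)).trans (Equiv.sumCongr (Equiv.refl κ)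
          ((Equiv.sumComm Unit (Fin m)).trans ((Equiv.optionEquivSumPUnit (Fin m)).symm.trans
            (finSuccEquiv m).symm)))
      rw [← kernelDet_comp_equiv f g e]
      congr 1
      ext i
      rcases i with (i | i) | i <;> simp [e]
    rw [← hmp.integral_comp']
    have hint' : Integrable (fun p : X × (Fin m → X) => kernelDet f g
        (Sum.elim x ((MeasurableEquiv.piFinSuccAbove (fun _ => X) 0).symm p)))
        (μ.prod (Measure.pi fun _ => μ)) :=
      (hmp.integrable_comp_emb (MeasurableEquiv.measurableEmbedding _)).mpr
        (integrable_kernelDet_sumElim hint x)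
    refine (integral_prod _ hint').trans ?_
    simp only [hre, ih]
    rw [integral_const_mul, integral_kernelDet_sumElim_unit hint horth, ← mul_assoc,
      Finset.prod_range_succ']
    congr 2
    · refine Finset.prod_congr rfl fun k _ => ?_
      simp
      ring
    · simp

end Determinantal

/-! ### Companion polynomials and the biorthogonal system -/

/-- A polynomial `P` of degree less than `N` has a companion polynomial `Q` of degree less than
`N`, such that `∑ (-x) ^ s / s! * P s = e ^ (-x) * Q x`; integrating `Q` against
`x ^ (β - 1) * e ^ (-x)` gives `Γ β * P (-β)`. -/
theorem exists_companion (N : ℕ) (P : Polynomial ℝ) (hP : P.degree < N) :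
    ∃ q : ℕ → ℝ,
      (∀ x : ℝ, HasSum (fun s : ℕ => (-x) ^ s / s.factorial * P.eval (s : ℝ))
        (Real.exp (-x) * ∑ k ∈ Finset.range N, q k * x ^ k)) ∧
      ∀ β : ℝ, 0 < β →
        ∑ k ∈ Finset.range N, q k * Real.Gamma (β + k) = Real.Gamma β * P.eval (-β) := by
  induction N generalizing P with
  | zero =>
    have : P = 0 := by simpa using hP
    subst this
    exact ⟨0, fun x => by simp, fun β _ => by simp⟩
  | succ N ih =>
    -- With `P(t + 1) = P(0) + (t + 1) R(t)`, the factor `s` cancels against `s!` and shifts the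
    -- series by one, so `q(x) = P(0) - x q_R(x)`. On the Gamma side this matches `Γ(β + 1) = β
    -- Γ(β)`.
    set R : Polynomial ℝ := P.divX.comp (Polynomial.X + 1) with hR
    have hev : ∀ t : ℝ, P.eval (t + 1) = P.coeff 0 + (t + 1) * R.eval t := by
      intro t
      conv_lhs => rw [← Polynomial.divX_mul_X_add P]
      simp [hR]
      ring
    have hdeg : R.degree < N := by
      by_cases h0 : P.divX = 0
      · rw [hR, h0]
        simp
      · rw [← Polynomial.natDegree_lt_iff_degree_lt]
        · rw [hR, Polynomial.natDegree_comp, Polynomial.natDegree_divX_eq_natDegree_tsub_one]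
          have h1 : P.natDegree ≤ N := by
            have hP0 : P ≠ 0 := fun h => h0 (by simp [h])
            exact Nat.lt_succ_iff.mp ((Polynomial.natDegree_lt_iff_degree_lt hP0).mpr hP)
          have h2 : P.natDegree ≠ 0 := by
            intro h
            exact h0 (Polynomial.divX_eq_zero_iff.mpr (Polynomial.eq_C_of_natDegree_eq_zero h))
          have h3 : (Polynomial.X + 1 : Polynomial ℝ).natDegree = 1 := by
            simpa using Polynomial.natDegree_X_add_C (1 : ℝ)
          rw [h3]
          omega
        · intro h
          rw [hR, Polynomial.comp_eq_zero_iff] at h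
          rcases h with h | ⟨_, h⟩
          · exact h0 h
          · have := congrArg Polynomial.natDegree h
            have h3 : (Polynomial.X + 1 : Polynomial ℝ).natDegree = 1 := by
              simpa using Polynomial.natDegree_X_add_C (1 : ℝ)
            rw [h3, Polynomial.natDegree_C] at this
            omega
    obtain ⟨q, hq, hΓ⟩ := ih R hdeg
    refine ⟨fun k => if k = 0 then P.coeff 0 else -q (k - 1), fun x => ?_, fun β hβ => ?_⟩
    · have h1 : HasSum (fun s : ℕ => (-x) ^ s / s.factorial * P.coeff 0)
          (Real.exp (-x) * P.coeff 0) := by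
        refine HasSum.mul_right _ ?_
        rw [Real.exp_eq_exp_ℝ]
        exact NormedSpace.expSeries_div_hasSum_exp (-x)
      have h2 : HasSum (fun s : ℕ => (-x) ^ s / s.factorial * (P.eval (s : ℝ) - P.coeff 0))
          (-x * (Real.exp (-x) * ∑ k ∈ Finset.range N, q k * x ^ k)) := by
        rw [← hasSum_nat_add_iff' 1]
        simp only [Finset.range_one, Finset.sum_singleton]
        have : (P.eval ((0 : ℕ) : ℝ) - P.coeff 0) = 0 := by
          simp [Polynomial.coeff_zero_eq_eval_zero]
        rw [this, mul_zero, sub_zero]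
        refine ((hq x).mul_left (-x)).congr_fun fun s => ?_
        push_cast
        rw [hev, pow_succ, Nat.factorial_succ]
        have := Nat.factorial_ne_zero s
        push_cast
        field_simp
        ring
      convert h1.add h2 using 1
      · ext s
        ring
      · rw [Finset.sum_range_succ']
        simp only [Nat.add_one_ne_zero, if_false, if_true, Nat.add_sub_cancel, pow_zero, mul_one]
        simp only [Finset.mul_sum, mul_add]
        rw [add_comm]
        congr 1
        exact Finset.sum_congr rfl fun k _ => by ring
    · rw [Finset.sum_range_succ']
      simp only [Nat.add_one_ne_zero, if_false, if_true, Nat.add_sub_cancel, Nat.cast_zero,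
        add_zero, neg_mul, Finset.sum_neg_distrib]
      have h1 := hΓ (β + 1) (by linarith)
      have h2 : ∀ k ∈ Finset.range N, q k * Real.Gamma (β + ((k + 1 : ℕ) : ℝ)) =
          q k * Real.Gamma (β + 1 + k) := fun k _ => by push_cast; ring_nf
      rw [Finset.sum_congr rfl h2, h1, Real.Gamma_add_one hβ.ne']
      have h3 := hev (-(β + 1))
      rw [show -(β + 1) + 1 = -β by ring] at h3
      rw [h3]
      ring


/-- The polynomial `∏ ((s + α + 1) / θ + j)` in `s`, over `j < N` with `j ≠ l`. -/
def nodePoly (α θ : ℝ) (N l : ℕ) : Polynomial ℝ :=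
  ∏ j ∈ (Finset.range N).erase l,
    (Polynomial.C (1 / θ) * Polynomial.X + Polynomial.C ((α + 1) / θ + j))

theorem eval_nodePoly (α θ : ℝ) (N l : ℕ) (s : ℝ) :
    (nodePoly α θ N l).eval s = ∏ j ∈ (Finset.range N).erase l, ((α + 1 + s) / θ + j) := by
  rw [nodePoly, Polynomial.eval_prod]
  refine Finset.prod_congr rfl fun j _ => ?_
  simp
  ring

theorem degree_nodePoly_lt (α θ : ℝ) {N l : ℕ} (hl : l < N) : (nodePoly α θ N l).degree < N := by
  have h1 : (nodePoly α θ N l).degree ≤ ((N - 1 : ℕ) : WithBot ℕ) := by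
    refine (Polynomial.degree_prod_le _ _).trans
      ((Finset.sum_le_sum fun j _ => Polynomial.degree_linear_le).trans ?_)
    simp [Finset.card_erase_of_mem (Finset.mem_range.mpr hl)]
  refine h1.trans_lt ?_
  exact_mod_cast (by omega : N - 1 < N)

/-- The nodes below `l` contribute `(-1) ^ l * l!` and the `m` nodes above it contribute `m!`. -/
theorem prod_erase_sub_self (l m : ℕ) :
    ∏ j ∈ (Finset.range (l + 1 + m)).erase l, ((j : ℝ) - l) =
      (-1) ^ l * l.factorial * m.factorial := by
  induction m with
  | zero =>
    have h : (Finset.range (l + 1 + 0)).erase l = Finset.range l := by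
      ext j
      simp
      omega
    rw [h, ← Finset.prod_range_reflect, Nat.factorial_zero, Nat.cast_one, mul_one,
      ← Finset.prod_range_add_one_eq_factorial, Nat.cast_prod]
    have h2 : ((-1 : ℝ)) ^ l = ∏ _j ∈ Finset.range l, (-1 : ℝ) := by simp
    rw [h2, ← Finset.prod_mul_distrib]
    refine Finset.prod_congr rfl fun j hj => ?_
    have := Finset.mem_range.mp hj
    rw [Nat.sub_sub, Nat.cast_sub (by omega)]
    push_cast
    ring
  | succ m ih =>
    have h : (Finset.range (l + 1 + (m + 1))).erase l =
        insert (l + 1 + m) ((Finset.range (l + 1 + m)).erase l) := by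
      ext j
      simp
      omega
    rw [h, Finset.prod_insert (by simp), ih, Nat.factorial_succ]
    push_cast
    ring

/-- The roots of `nodePoly` are the points `-(α + 1 + θ j)` with `j ≠ l`. This is the source of
biorthogonality; the value at the omitted node fixes `laguerreCoeff`. -/
theorem eval_nodePoly_neg {α θ : ℝ} (hθ : θ ≠ 0) {N l l' : ℕ} (hl : l < N) (hl' : l' < N) :
    (nodePoly α θ N l).eval (-(α + 1 + θ * l')) =
      if l = l' then (-1 : ℝ) ^ l * l.factorial * (N - 1 - l).factorial else 0 := by
  have h : ∀ j : ℕ, (α + 1 + -(α + 1 + θ * l')) / θ + j = (j : ℝ) - l' := fun j => by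
    field_simp
    ring
  simp only [eval_nodePoly, h]
  split_ifs with hll
  · subst hll
    obtain ⟨m, rfl⟩ := Nat.exists_eq_add_of_lt hl
    rw [show l + m + 1 = l + 1 + m by ring, prod_erase_sub_self]
    congr 3
    omega
  · exact Finset.prod_eq_zero (i := l') (by simp [hl', Ne.symm hll]) (by simp)

/-- The coefficients of the companion polynomial of `nodePoly α θ N l`. -/
def companionCoeff (α θ : ℝ) (N : ℕ) (l : Fin N) : ℕ → ℝ :=
  (exists_companion N (nodePoly α θ N l) (degree_nodePoly_lt α θ l.2)).choose

theorem hasSum_companionCoeff (α θ : ℝ) (N : ℕ) (l : Fin N) (x : ℝ) :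
    HasSum (fun s : ℕ => (-x) ^ s / s.factorial * (nodePoly α θ N l).eval (s : ℝ))
      (Real.exp (-x) * ∑ k ∈ Finset.range N, companionCoeff α θ N l k * x ^ k) :=
  (exists_companion N (nodePoly α θ N l) (degree_nodePoly_lt α θ l.2)).choose_spec.1 x

theorem sum_companionCoeff_mul_Gamma (α θ : ℝ) (N : ℕ) (l : Fin N) {β : ℝ} (hβ : 0 < β) :
    ∑ k ∈ Finset.range N, companionCoeff α θ N l k * Real.Gamma (β + k) =
      Real.Gamma β * (nodePoly α θ N l).eval (-β) :=
  (exists_companion N (nodePoly α θ N l) (degree_nodePoly_lt α θ l.2)).choose_spec.2 β hβ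

/-- The normalisation of the left biorthogonal functions. -/
def laguerreCoeff (α θ : ℝ) (N l : ℕ) : ℝ :=
  (-1) ^ l / (l.factorial * Real.Gamma (α + 1 + θ * l) * (N - 1 - l).factorial)

/-- The left biorthogonal functions of the Laguerre ensemble. -/
def laguerreLeft (α θ : ℝ) (N : ℕ) (l : Fin N) (x : ℝ) : ℝ :=
  x ^ α * Real.exp (-x) *
    ∑ k : Fin N, x ^ (k : ℕ) * (laguerreCoeff α θ N l * companionCoeff α θ N l k)

/-- The right biorthogonal functions of the Laguerre ensemble. -/
def laguerreRight (θ : ℝ) (N : ℕ) (l : Fin N) (x : ℝ) : ℝ := (x ^ θ) ^ (l : ℕ)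

theorem laguerreLeft_mul_laguerreRight (α θ : ℝ) (N : ℕ) (l l' : Fin N) {x : ℝ} (hx : 0 < x) :
    laguerreLeft α θ N l x * laguerreRight θ N l' x =
      ∑ k ∈ Finset.range N, laguerreCoeff α θ N l * companionCoeff α θ N l k *
        (Real.exp (-x) * x ^ (α + 1 + θ * l' + k - 1)) := by
  rw [laguerreLeft, laguerreRight, Finset.mul_sum, Finset.sum_mul, Finset.sum_range]
  refine Finset.sum_congr rfl fun k _ => ?_
  rw [show α + 1 + θ * (l' : ℕ) + (k : ℕ) - 1 = α + θ * (l' : ℕ) + (k : ℕ) by ring,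
    Real.rpow_add hx, Real.rpow_add hx, Real.rpow_mul hx.le, Real.rpow_natCast,
    Real.rpow_natCast]
  ring

section

variable {α θ : ℝ} (hα : -1 < α) (hθ : 0 < θ)
include hα hθ

theorem integrable_laguerreLeft_mul_laguerreRight (N : ℕ) (l l' : Fin N) :
    Integrable (fun x => laguerreLeft α θ N l x * laguerreRight θ N l' x)
      (volume.restrict (Set.Ioi 0)) := by
  have h : IntegrableOn (fun x => ∑ k ∈ Finset.range N,
      laguerreCoeff α θ N l * companionCoeff α θ N l k *
        (Real.exp (-x) * x ^ (α + 1 + θ * (l' : ℕ) + k - 1))) (Set.Ioi 0) :=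
    integrable_finsetSum _ fun k _ => (Real.GammaIntegral_convergent
      (add_pos_of_pos_of_nonneg (add_pos_of_pos_of_nonneg (by linarith) (by positivity))
        (by positivity))).const_mul _
  exact h.congr_fun (fun x hx => (laguerreLeft_mul_laguerreRight α θ N l l' hx).symm)
    measurableSet_Ioi

/-- Termwise Gamma integrals sum to `Γ(β) P(-β)` with `β = α + 1 + θ l'` and `P` the node polynomial
of `l`. -/
theorem integral_laguerreLeft_mul_laguerreRight (N : ℕ) (l l' : Fin N) :
    ∫ x in Set.Ioi 0, laguerreLeft α θ N l x * laguerreRight θ N l' x =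
      if l = l' then 1 else 0 := by
  have hβ : ∀ l : ℕ, 0 < α + 1 + θ * (l : ℕ) := fun l =>
    add_pos_of_pos_of_nonneg (by linarith) (by positivity)
  rw [setIntegral_congr_fun measurableSet_Ioi fun x hx =>
    laguerreLeft_mul_laguerreRight α θ N l l' hx]
  rw [integral_finsetSum _ fun k _ => (Real.GammaIntegral_convergent
      (add_pos_of_pos_of_nonneg (hβ l') (by positivity))).const_mul _]
  simp only [integral_const_mul]
  have h : ∀ k ∈ Finset.range N, laguerreCoeff α θ N l * companionCoeff α θ N l k *
      (∫ x in Set.Ioi 0, Real.exp (-x) * x ^ (α + 1 + θ * (l' : ℕ) + k - 1)) =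
      laguerreCoeff α θ N l *
        (companionCoeff α θ N l k * Real.Gamma (α + 1 + θ * (l' : ℕ) + k)) := fun k _ => by
    rw [Real.Gamma_eq_integral (add_pos_of_pos_of_nonneg (hβ l') (by positivity))]
    ring
  rw [Finset.sum_congr rfl h, ← Finset.mul_sum, sum_companionCoeff_mul_Gamma _ _ _ _ (hβ l'),
    eval_nodePoly_neg hθ.ne' l.2 l'.2]
  simp only [Fin.ext_iff]
  split_ifs with hl
  · rw [hl, laguerreCoeff]
    have h1 := (Real.Gamma_pos_of_pos (hβ l')).ne'
    have h2 : (((-1 : ℝ)) ^ (l' : ℕ)) * (-1) ^ (l' : ℕ) = 1 := by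
      rw [← mul_pow]
      simp
    have h3 : ((l' : ℕ).factorial : ℝ) ≠ 0 := by positivity
    have h4 : ((N - 1 - (l' : ℕ)).factorial : ℝ) ≠ 0 := by positivity
    field_simp
    linear_combination h2
  · simp

end

/-! ### The ensemble as a determinantal process -/

/-- The coefficient matrix of the left biorthogonal functions. -/
def laguerreCoeffMatrix (α θ : ℝ) (N : ℕ) : Matrix (Fin N) (Fin N) ℝ :=
  Matrix.of fun k l => laguerreCoeff α θ N l * companionCoeff α θ N l k

/-- The kernel matrix factors as diagonal weight, Vandermonde in `x`, coefficient matrix, transposed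
Vandermonde in `x ^ θ`. -/
theorem kernelDet_laguerre (α θ : ℝ) (N : ℕ) (x : Fin N → ℝ) :
    kernelDet (laguerreLeft α θ N) (laguerreRight θ N) x =
      (laguerreCoeffMatrix α θ N).det * laguerreWeight α θ N x := by
  have h : (Matrix.of fun i j => finiteRankKernel (laguerreLeft α θ N) (laguerreRight θ N)
      (x i) (x j)) = Matrix.diagonal (fun i => x i ^ α * Real.exp (-x i)) *
        (Matrix.vandermonde x * laguerreCoeffMatrix α θ N) *
        (Matrix.vandermonde fun i => x i ^ θ).transpose := by
    ext i j
    rw [Matrix.of_apply, finiteRankKernel, Matrix.mul_apply]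
    refine Finset.sum_congr rfl fun l _ => ?_
    rw [Matrix.diagonal_mul, Matrix.mul_apply]
    rfl
  rw [kernelDet, h, Matrix.det_mul, Matrix.det_mul, Matrix.det_mul, Matrix.det_diagonal,
    Matrix.det_transpose, Matrix.det_vandermonde, Matrix.det_vandermonde, laguerreWeight]
  have h2 : (∏ i, ∏ j ∈ Finset.Ioi i, (x i - x j) * (x i ^ θ - x j ^ θ)) =
      (∏ i, ∏ j ∈ Finset.Ioi i, (x j - x i)) * ∏ i, ∏ j ∈ Finset.Ioi i, (x j ^ θ - x i ^ θ) := by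
    simp only [← Finset.prod_mul_distrib]
    exact Finset.prod_congr rfl fun i _ => Finset.prod_congr rfl fun j _ => by ring
  rw [h2]
  ring

theorem volume_restrict_posOrthant (m : ℕ) :
    volume.restrict (posOrthant m) =
      Measure.pi fun _ : Fin m => volume.restrict (Set.Ioi (0 : ℝ)) := by
  rw [posOrthant, volume_pi, Measure.restrict_pi_pi]

theorem kernelDet_joinPoints {ι : Type*} [Fintype ι] (f g : ι → ℝ → ℝ) {n N : ℕ} (hn : n ≤ N)
    (x : Fin n → ℝ) (y : Fin (N - n) → ℝ) :
    kernelDet f g (joinPoints x y : Fin N → ℝ) = kernelDet f g (Sum.elim x y) := by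
  rw [← kernelDet_comp_equiv f g
    (finSumFinEquiv.trans (finCongr (by omega)) : Fin n ⊕ Fin (N - n) ≃ Fin N)]
  congr 1
  ext i
  rcases i with i | i
  · simp [joinPoints]
  · simp [joinPoints]

section

variable {α θ : ℝ} (hα : -1 < α) (hθ : 0 < θ)
include hα hθ

theorem integrableOn_kernelDet_joinPoints {n N : ℕ} (hn : n ≤ N) (x : Fin n → ℝ) :
    IntegrableOn (fun y => kernelDet (laguerreLeft α θ N) (laguerreRight θ N)
      (joinPoints x y : Fin N → ℝ)) (posOrthant (N - n)) := by
  rw [IntegrableOn, volume_restrict_posOrthant]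
  simp only [kernelDet_joinPoints _ _ hn]
  exact integrable_kernelDet_sumElim (integrable_laguerreLeft_mul_laguerreRight hα hθ N) x

theorem integral_kernelDet_joinPoints {n N : ℕ} (hn : n ≤ N) (x : Fin n → ℝ) :
    ∫ y in posOrthant (N - n), kernelDet (laguerreLeft α θ N) (laguerreRight θ N)
      (joinPoints x y : Fin N → ℝ) =
        (N - n).factorial * kernelDet (laguerreLeft α θ N) (laguerreRight θ N) x := by
  rw [volume_restrict_posOrthant]
  simp only [kernelDet_joinPoints _ _ hn]
  rw [integral_kernelDet_sumElim (integrable_laguerreLeft_mul_laguerreRight hα hθ N)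
    (integral_laguerreLeft_mul_laguerreRight hα hθ N)]
  congr 1
  rw [← Nat.descFactorial_self, Nat.descFactorial_eq_prod_range, Nat.cast_prod]
  refine Finset.prod_congr rfl fun k hk => ?_
  have := Finset.mem_range.mp hk
  rw [Nat.cast_sub (by omega), Nat.cast_sub hn]
  simp

/-- Integrate out all `N` variables, starting from the empty determinant 1. Neither factor has to be
computed: the product already shows that both are nonzero. -/
theorem det_laguerreCoeffMatrix_mul_laguerreZ (N : ℕ) :
    (laguerreCoeffMatrix α θ N).det * laguerreZ α θ N = N.factorial := by
  have hj : ∀ y : Fin N → ℝ, (joinPoints (Fin.elim0 : Fin 0 → ℝ) y : Fin N → ℝ) = y := fun y => by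
    ext i
    simp [joinPoints]
  have h := integral_kernelDet_joinPoints hα hθ (Nat.zero_le N) Fin.elim0
  have h0 : kernelDet (laguerreLeft α θ N) (laguerreRight θ N) (Fin.elim0 : Fin 0 → ℝ) = 1 :=
    Matrix.det_isEmpty
  rw [h0, mul_one] at h
  rw [laguerreZ, ← integral_const_mul, ← Nat.sub_zero N, ← h]
  simp only [Nat.sub_zero, hj, kernelDet_laguerre]

theorem integrableOn_laguerreWeight_joinPoints {n N : ℕ} (hn : n ≤ N) (x : Fin n → ℝ) :
    IntegrableOn (fun y => laguerreWeight α θ N (joinPoints x y)) (posOrthant (N - n)) := by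
  have hd : (laguerreCoeffMatrix α θ N).det ≠ 0 := fun h0 => by
    have h := det_laguerreCoeffMatrix_mul_laguerreZ hα hθ N
    rw [h0, zero_mul] at h
    exact Nat.factorial_ne_zero N (by exact_mod_cast h.symm)
  have h := (integrableOn_kernelDet_joinPoints hα hθ hn x).const_mul
    (laguerreCoeffMatrix α θ N).det⁻¹
  simpa only [IntegrableOn, kernelDet_laguerre, inv_mul_cancel_left₀ hd] using h

/-- The value is nonzero by the previous identity, and the weight is nonnegative because `x ↦ x ^ θ`
preserves order. -/
theorem laguerreZ_pos (N : ℕ) : 0 < laguerreZ α θ N := by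
  have hne : laguerreZ α θ N ≠ 0 := fun h0 => by
    have h := det_laguerreCoeffMatrix_mul_laguerreZ hα hθ N
    rw [h0, mul_zero] at h
    exact Nat.factorial_ne_zero N (by exact_mod_cast h.symm)
  refine lt_of_le_of_ne (setIntegral_nonneg (MeasurableSet.univ_pi fun _ => measurableSet_Ioi)
    fun x hx => ?_) hne.symm
  have hx : ∀ i, 0 < x i := fun i => hx i trivial
  refine mul_nonneg (Finset.prod_nonneg fun i _ => Finset.prod_nonneg fun j _ => ?_)
    (Finset.prod_nonneg fun i _ => by have := hx i; positivity)
  rcases le_total (x i) (x j) with h | h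
  · exact mul_nonneg_of_nonpos_of_nonpos (by linarith)
      (by linarith [Real.rpow_le_rpow (hx i).le h hθ.le])
  · exact mul_nonneg (by linarith) (by linarith [Real.rpow_le_rpow (hx j).le h hθ.le])

theorem laguerreDensity_eq_kernelDet (N : ℕ) (x : Fin N → ℝ) :
    laguerreDensity α θ N x =
      (N.factorial : ℝ)⁻¹ * kernelDet (laguerreLeft α θ N) (laguerreRight θ N) x := by
  have h := det_laguerreCoeffMatrix_mul_laguerreZ hα hθ N
  have hZ := (laguerreZ_pos hα hθ N).ne'
  rw [laguerreDensity, kernelDet_laguerre, ← h]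
  have hd : (laguerreCoeffMatrix α θ N).det ≠ 0 := fun h0 => by
    rw [h0, zero_mul] at h
    exact Nat.factorial_ne_zero N (by exact_mod_cast h.symm)
  field_simp

/-- The correlation functions of the Laguerre ensemble are determinantal. -/
theorem laguerreCorrelation_eq_kernelDet {n N : ℕ} (hn : n ≤ N) (x : Fin n → ℝ) :
    laguerreCorrelation α θ n N x =
      kernelDet (laguerreLeft α θ N) (laguerreRight θ N) x := by
  simp only [laguerreCorrelation, laguerreDensity_eq_kernelDet hα hθ]
  rw [integral_const_mul, integral_kernelDet_joinPoints hα hθ hn]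
  have h : ((N - n).factorial : ℝ) * N.descFactorial n = N.factorial := by
    exact_mod_cast Nat.factorial_mul_descFactorial hn
  have h1 : (N.factorial : ℝ) ≠ 0 := by positivity
  field_simp
  linear_combination kernelDet (laguerreLeft α θ N) (laguerreRight θ N) x * h

end


/-! ### Asymptotics and bounds for Gamma ratios and falling factorials -/

theorem exists_Gamma_inv_le : ∃ C : ℝ, 0 < C ∧ ∀ a : ℝ, 0 < a → (Real.Gamma a)⁻¹ ≤ C := by
  obtain ⟨x, hx, hmin⟩ := Real.exists_isMinOn_Gamma_Ioi
  have hx0 : 0 < x := by linarith [hx.1]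
  refine ⟨(Real.Gamma x)⁻¹, inv_pos.mpr (Real.Gamma_pos_of_pos hx0), fun a ha => ?_⟩
  exact inv_anti₀ (Real.Gamma_pos_of_pos hx0) (hmin ha)

theorem Gamma_add_natCast_eq_prod_mul {a : ℝ} (ha : 0 < a) (n : ℕ) :
    Real.Gamma (a + n) = (∏ j ∈ Finset.range n, (a + j)) * Real.Gamma a := by
  induction n with
  | zero => simp
  | succ n ih =>
    rw [Finset.prod_range_succ, Nat.cast_succ, ← add_assoc, Real.Gamma_add_one (by positivity), ih]
    ring

/-- The ratio `Γ (a + N) / (Γ N * N ^ a)`. -/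
def gammaRatio (a : ℝ) (N : ℕ) : ℝ :=
  Real.Gamma (a + N) / ((N - 1).factorial * (N : ℝ) ^ a)

theorem gammaRatio_nonneg {a : ℝ} (ha : 0 < a) (N : ℕ) : 0 ≤ gammaRatio a N := by
  have := Real.Gamma_pos_of_pos (show 0 < a + N by positivity)
  unfold gammaRatio
  positivity

/-- Euler's limit formula: the ratio is `Γ(a) / GammaSeq a n` times `n / (n + a)`. -/
theorem tendsto_gammaRatio {a : ℝ} (ha : 0 < a) : Tendsto (gammaRatio a) atTop (𝓝 1) := by
  have hΓ := (Real.Gamma_pos_of_pos ha).ne'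
  have h1 : Tendsto (fun n : ℕ => Real.Gamma a / Real.GammaSeq a n) atTop (𝓝 1) := by
    rw [← div_self hΓ]
    exact tendsto_const_nhds.div (Real.GammaSeq_tendsto_Gamma a) hΓ
  have h2 : Tendsto (fun n : ℕ => (n : ℝ) / (n + a)) atTop (𝓝 1) :=
    tendsto_natCast_div_add_atTop a
  have h3 := h1.mul h2
  rw [one_mul] at h3
  refine h3.congr' ?_
  filter_upwards [eventually_ge_atTop 1] with n hn
  have hn0 : (0 : ℝ) < n := by exact_mod_cast hn
  rw [gammaRatio, Real.GammaSeq, Gamma_add_natCast_eq_prod_mul ha, Finset.prod_range_succ,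
    ← Nat.mul_factorial_pred (by omega : n ≠ 0)]
  have hp : ∏ j ∈ Finset.range n, (a + (j : ℝ)) ≠ 0 :=
    (Finset.prod_pos fun j _ => by positivity).ne'
  have hf : ((n - 1).factorial : ℝ) ≠ 0 := by positivity
  have hr : (n : ℝ) ^ a ≠ 0 := (Real.rpow_pos_of_pos hn0 a).ne'
  have hna : (n : ℝ) + a ≠ 0 := by positivity
  push_cast
  field_simp
  ring

/-- For `a < 1`, log-convexity of `Γ` bounds the ratio by 1. For `a ≥ 1`, Bernoulli's inequality
makes it nonincreasing in `N`, and its value at `N = 1` is `Γ(a + 1)`. -/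
theorem gammaRatio_le {a : ℝ} (ha : 0 < a) {N : ℕ} (hN : 1 ≤ N) :
    gammaRatio a N ≤ 1 + Real.Gamma (a + 1) := by
  have hΓ := Real.Gamma_pos_of_pos (show 0 < a + 1 by positivity)
  obtain ⟨n, rfl⟩ := Nat.exists_eq_add_of_le' hN
  rcases lt_or_ge a 1 with h | h
  · have hn : (0 : ℝ) < n + 1 := by positivity
    have key := Real.Gamma_mul_add_mul_le_rpow_Gamma_mul_rpow_Gamma (s := n + 1) (t := n + 1 + 1)
      hn (by positivity) (show 0 < 1 - a by linarith) ha (by ring)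
    rw [Real.Gamma_add_one hn.ne', Real.Gamma_nat_eq_factorial, Real.mul_rpow hn.le (by positivity),
      mul_left_comm, ← Real.rpow_add (by positivity), sub_add_cancel, Real.rpow_one,
      show (1 - a) * ((n : ℝ) + 1) + a * (n + 1 + 1) = a + (n + 1) by ring] at key
    have : gammaRatio a (n + 1) ≤ 1 := by
      rw [gammaRatio, Nat.add_sub_cancel]
      push_cast
      rw [div_le_one (by positivity)]
      linarith
    linarith
  · suffices gammaRatio a (n + 1) ≤ Real.Gamma (a + 1) by linarith
    induction n with
    | zero => simp [gammaRatio]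
    | succ n ih =>
      refine le_trans ?_ (ih (by omega))
      have hn : (0 : ℝ) < n + 1 := by positivity
      have hb := one_add_mul_self_le_rpow_one_add (s := 1 / ((n : ℝ) + 1))
        (le_trans (by norm_num) (show (0 : ℝ) ≤ 1 / ((n : ℝ) + 1) by positivity)) h
      rw [show 1 + a * (1 / ((n : ℝ) + 1)) = (a + (n + 1)) / (n + 1) by field_simp; ring,
        show 1 + 1 / ((n : ℝ) + 1) = (n + 1 + 1) / (n + 1) by field_simp,
        Real.div_rpow (by positivity) hn.le, div_le_div_iff₀ hn (by positivity)] at hb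
      rw [gammaRatio, gammaRatio, Nat.add_sub_cancel, Nat.add_sub_cancel, Nat.factorial_succ]
      push_cast
      rw [← add_assoc a, Real.Gamma_add_one (by positivity),
        div_le_div_iff₀ (by positivity) (by positivity)]
      have hG := Real.Gamma_pos_of_pos (show 0 < a + ((n : ℝ) + 1) by positivity)
      have := mul_le_mul_of_nonneg_left hb
        (show 0 ≤ Real.Gamma (a + ((n : ℝ) + 1)) * n.factorial by positivity)
      linarith

theorem tendsto_descFactorial_div_pow (l : ℕ) :
    Tendsto (fun N : ℕ => ((N - 1).descFactorial l : ℝ) / (N : ℝ) ^ l) atTop (𝓝 1) := by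
  have h : ∀ i : ℕ, Tendsto (fun N : ℕ => ((N : ℝ) - (1 + i)) / N) atTop (𝓝 1) := fun i => by
    have h0 := (tendsto_const_div_atTop_nhds_zero_nat (1 + (i : ℝ))).const_sub 1
    rw [sub_zero] at h0
    refine h0.congr' ?_
    filter_upwards [eventually_ge_atTop 1] with N hN
    have : (N : ℝ) ≠ 0 := by positivity
    field_simp
  have h2 := tendsto_finsetProd (Finset.range l) fun i _ => h i
  rw [Finset.prod_const_one] at h2
  refine h2.congr' ?_
  filter_upwards [eventually_ge_atTop (l + 1)] with N hN
  rw [Nat.descFactorial_eq_prod_range, Finset.prod_div_distrib, Finset.prod_const,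
    Finset.card_range, Nat.cast_prod]
  congr 1
  refine Finset.prod_congr rfl fun i hi => ?_
  have := Finset.mem_range.mp hi
  rw [Nat.sub_sub, Nat.cast_sub (by omega)]
  push_cast
  ring

theorem descFactorial_div_pow_le_one (l N : ℕ) :
    ((N - 1).descFactorial l : ℝ) / (N : ℝ) ^ l ≤ 1 := by
  refine div_le_one_of_le₀ ?_ (by positivity)
  exact_mod_cast (Nat.descFactorial_le_pow _ _).trans (Nat.pow_le_pow_left (Nat.sub_le _ _) _)


/-! ### Wright's functions and the limit kernel -/

theorem abs_wrightTerm_le {a b C : ℝ} (ha : 0 < a) (hb : 0 < b)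
    (hC : ∀ a : ℝ, 0 < a → (Real.Gamma a)⁻¹ ≤ C) (s : ℝ) (m : ℕ) :
    |wrightTerm a b s m| ≤ C * (|s| ^ m / m.factorial) := by
  have hpos : 0 < a + b * m := by positivity
  have hΓ := Real.Gamma_pos_of_pos hpos
  rw [wrightTerm, abs_div, abs_pow, abs_neg, abs_of_pos (show 0 <
    (m.factorial : ℝ) * Real.Gamma (a + b * m) by positivity), ← div_div, div_eq_mul_inv,
    mul_comm C]
  exact mul_le_mul_of_nonneg_left (hC _ hpos) (by positivity)

theorem summable_abs_wrightTerm {a b : ℝ} (ha : 0 < a) (hb : 0 < b) (s : ℝ) :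
    Summable fun m => |wrightTerm a b s m| := by
  obtain ⟨C, -, hC⟩ := exists_Gamma_inv_le
  exact Summable.of_nonneg_of_le (fun _ => abs_nonneg _) (abs_wrightTerm_le ha hb hC s)
    ((Real.summable_pow_div_factorial _).mul_left C)

theorem continuous_wrightJ {a b : ℝ} (ha : 0 < a) (hb : 0 < b) : Continuous (wrightJ a b) := by
  obtain ⟨C, hC0, hC⟩ := exists_Gamma_inv_le
  refine continuous_iff_continuousAt.mpr fun s => ?_
  have h : ContinuousOn (wrightJ a b) (Metric.ball 0 (|s| + 1)) := by
    refine continuousOn_tsum (u := fun m : ℕ => C * ((|s| + 1) ^ m / m.factorial))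
      (fun m => ?_) ((Real.summable_pow_div_factorial _).mul_left C) fun m t ht => ?_
    · unfold wrightTerm
      fun_prop
    · refine (abs_wrightTerm_le ha hb hC t m).trans ?_
      have : |t| ≤ |s| + 1 := by simpa using (mem_ball_zero_iff.mp ht).le
      gcongr
  exact h.continuousAt (Metric.isOpen_ball.mem_nhds (by simp))

section

variable {α θ : ℝ} (hα : -1 < α) (hθ : 0 < θ)
include hα hθ

theorem intervalIntegrable_wrightIntegrand (x y : ℝ) :
    IntervalIntegrable (wrightIntegrand α θ x y) volume 0 1 := by
  have ha : 0 < (α + 1) / θ := div_pos (by linarith) hθ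
  refine (intervalIntegral.intervalIntegrable_rpow' hα).continuousOn_mul
    (Continuous.continuousOn ?_)
  refine ((continuous_wrightJ ha (by positivity)).comp (by fun_prop)).mul
    ((continuous_wrightJ (by linarith) hθ).comp ?_)
  exact (continuous_const.mul continuous_id).rpow_const fun _ => Or.inr hθ.le

/-- A summable majorant of the terms of the double series and of its finite-`N` analogues. -/
theorem exists_summable_limitKernelTerm_bound {x y : ℝ} (hx : 0 < x) (hy : 0 < y) :
    ∃ b : ℕ × ℕ → ℝ, Summable b ∧ ∀ p : ℕ × ℕ,
      |limitKernelTerm α θ x y p| * (1 + Real.Gamma ((α + 1 + p.1) / θ + 1)) ≤ b p := by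
  obtain ⟨C, hC0, hC⟩ := exists_Gamma_inv_le
  have hα1 : 0 < α + 1 := by linarith
  -- With `a = (α + 1 + k) / θ`, the factor `1 / Γ(a)` of the term absorbs `Γ(a + 1) = a Γ(a)`,
  -- leaving at most `C + a`, linear in `k`.
  refine ⟨fun p => (x ^ p.1 / p.1.factorial * (C + (α + 1 + p.1) / θ)) *
    (C * ((y ^ θ) ^ p.2 / p.2.factorial) * (θ / (α + 1))), ?_, fun p => ?_⟩
  · refine Summable.mul_of_nonneg (f := fun k : ℕ => x ^ k / k.factorial * (C + (α + 1 + k) / θ))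
      (g := fun l : ℕ => C * ((y ^ θ) ^ l / l.factorial) * (θ / (α + 1))) ?_
      (((Real.summable_pow_div_factorial _).mul_left C).mul_right _)
      (fun k => by positivity) (fun l => by positivity)
    have h1 := (Real.summable_pow_div_factorial x).mul_right (C + (α + 1) / θ)
    have h2 := (Real.summable_pow_div_factorial (2 * x)).mul_right (1 / θ)
    refine Summable.of_nonneg_of_le (fun k => by positivity) (fun k => ?_) (h1.add h2)
    -- The linear growth is paid for by the exponential series at `2 * x`.
    have h3 : (k : ℝ) ≤ 2 ^ k := by exact_mod_cast Nat.lt_two_pow_self.le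
    have h4 : x ^ k / k.factorial * (C + (α + 1 + k) / θ) =
        x ^ k / k.factorial * (C + (α + 1) / θ) + x ^ k / k.factorial * (1 / θ) * k := by ring
    have h5 : (2 * x) ^ k / k.factorial * (1 / θ) =
        x ^ k / k.factorial * (1 / θ) * 2 ^ k := by
      rw [mul_pow]
      ring
    rw [h4, h5]
    gcongr
  · obtain ⟨k, l⟩ := p
    have hak : 0 < (α + 1 + k) / θ := by positivity
    have hal : 0 < α + 1 + θ * l := by positivity
    have hΓk := Real.Gamma_pos_of_pos hak
    have hΓl := Real.Gamma_pos_of_pos hal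
    have hden : 0 < α + 1 + k + θ * l := by positivity
    have habs : |limitKernelTerm α θ x y (k, l)| =
        x ^ k / k.factorial * (Real.Gamma ((α + 1 + k) / θ))⁻¹ *
          ((Real.Gamma (α + 1 + θ * l))⁻¹ * ((y ^ θ) ^ l / l.factorial) *
            (θ / (α + 1 + k + θ * l))) := by
      simp only [limitKernelTerm, abs_mul, abs_div, abs_pow, abs_neg, abs_one, one_pow, one_mul,
        Nat.abs_cast, abs_of_pos hx, abs_of_pos hθ, abs_of_pos hΓk, abs_of_pos hΓl,
        abs_of_pos hden, abs_of_pos (Real.rpow_pos_of_pos hy _), Real.rpow_mul hy.le,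
        Real.rpow_natCast]
      field_simp
    have hfac : (Real.Gamma ((α + 1 + k) / θ))⁻¹ * (1 + Real.Gamma ((α + 1 + k) / θ + 1)) ≤
        C + (α + 1 + k) / θ := by
      rw [Real.Gamma_add_one hak.ne', mul_add, mul_one, mul_comm ((α + 1 + k) / θ),
        inv_mul_cancel_left₀ hΓk.ne']
      linarith [hC _ hak]
    rw [habs]
    calc _ = x ^ k / k.factorial *
          ((Real.Gamma ((α + 1 + k) / θ))⁻¹ * (1 + Real.Gamma ((α + 1 + k) / θ + 1))) *
          ((Real.Gamma (α + 1 + θ * l))⁻¹ * ((y ^ θ) ^ l / l.factorial) *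
            (θ / (α + 1 + k + θ * l))) := by ring
      _ ≤ _ := by
        have h1 := hC _ hal
        have h2 : α + 1 ≤ α + 1 + k + θ * l := by
          have : 0 ≤ θ * l := by positivity
          have : (0 : ℝ) ≤ k := by positivity
          linarith
        have h3 : 0 < Real.Gamma ((α + 1 + k) / θ + 1) := Real.Gamma_pos_of_pos (by positivity)
        dsimp only
        gcongr

theorem summable_abs_limitKernelTerm {x y : ℝ} (hx : 0 < x) (hy : 0 < y) :
    Summable fun p => |limitKernelTerm α θ x y p| := by
  obtain ⟨b, hb, hle⟩ := exists_summable_limitKernelTerm_bound hα hθ hx hy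
  refine Summable.of_nonneg_of_le (fun _ => abs_nonneg _) (fun p => ?_) hb
  refine le_trans (le_mul_of_one_le_right (abs_nonneg _) ?_) (hle p)
  have hα1 : 0 < α + 1 := by linarith
  linarith [Real.Gamma_pos_of_pos (show 0 < (α + 1 + p.1) / θ + 1 by positivity)]

/-- Write `1 / (α + 1 + k + θ l)` as the integral of `t ^ (α + k + θ l)` over `(0, 1]`; the double
series then factors under the integral. Sum and integral may be exchanged because the `L¹` norms are
the absolute terms divided by `θ`. -/
theorem limitKernel_eq_integral {x y : ℝ} (hx : 0 < x) (hy : 0 < y) :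
    limitKernel α θ x y = θ * ∫ t in (0 : ℝ)..1, wrightIntegrand α θ x y t := by
  have hα1 : 0 < α + 1 := by linarith
  let e : ℕ × ℕ → ℝ := fun p => α + p.1 + θ * p.2
  have he : ∀ p, -1 < e p := fun p => by
    have h1 : 0 ≤ θ * p.2 := by positivity
    have h2 : (0 : ℝ) ≤ p.1 := by positivity
    simp only [e]
    linarith
  have he' : ∀ p, 0 < e p + 1 := fun p => by linarith [he p]
  let c : ℕ × ℕ → ℝ := fun p => limitKernelTerm α θ x y p / θ * (e p + 1)
  let F : ℕ × ℕ → ℝ → ℝ := fun p t => c p * t ^ e p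
  have hpow : ∀ p, ∫ t in Set.Ioc (0 : ℝ) 1, t ^ e p = 1 / (e p + 1) := fun p => by
    rw [← intervalIntegral.integral_of_le zero_le_one, integral_rpow (Or.inl (he p)),
      Real.one_rpow, Real.zero_rpow (he' p).ne', sub_zero]
  have hint : ∀ p, Integrable (F p) (volume.restrict (Set.Ioc 0 1)) := fun p =>
    ((intervalIntegrable_iff_integrableOn_Ioc_of_le zero_le_one).mp
      (intervalIntegral.intervalIntegrable_rpow' (he p))).const_mul _
  have hval : ∀ p, ∫ t in Set.Ioc (0 : ℝ) 1, F p t = limitKernelTerm α θ x y p / θ := fun p => by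
    simp only [F]
    rw [integral_const_mul, hpow]
    have := (he' p).ne'
    simp only [c]
    field_simp
  have hnorm : ∀ p, ∫ t in Set.Ioc (0 : ℝ) 1, ‖F p t‖ = |limitKernelTerm α θ x y p| / θ :=
    fun p => by
    have h : ∀ t ∈ Set.Ioc (0 : ℝ) 1, ‖F p t‖ = |c p| * t ^ e p := fun t ht => by
      rw [Real.norm_eq_abs, abs_mul, abs_of_nonneg (Real.rpow_nonneg ht.1.le _)]
    rw [setIntegral_congr_fun measurableSet_Ioc h, integral_const_mul, hpow]
    have := (he' p).ne'
    simp only [c]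
    rw [abs_mul, abs_of_pos (he' p), abs_div, abs_of_pos hθ]
    field_simp
  have hF : ∀ t ∈ Set.Ioc (0 : ℝ) 1, ∑' p, F p t = wrightIntegrand α θ x y t := by
    intro t ht
    have ht0 := ht.1
    have h1 : Summable fun m => ‖wrightTerm ((α + 1) / θ) (1 / θ) (x * t) m‖ :=
      summable_abs_wrightTerm (div_pos hα1 hθ) (one_div_pos.mpr hθ) (x * t)
    have h2 : Summable fun m => ‖wrightTerm (α + 1) θ ((y * t) ^ θ) m‖ :=
      summable_abs_wrightTerm hα1 hθ ((y * t) ^ θ)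
    have h3 := tsum_mul_tsum_of_summable_norm h1 h2
    rw [wrightIntegrand, wrightJ, wrightJ, h3, ← tsum_mul_right]
    refine tsum_congr fun p => ?_
    obtain ⟨k, l⟩ := p
    have hd : α + 1 + k + θ * l ≠ 0 := by
      have := (he' (k, l)).ne'
      simp only [e] at this
      convert this using 1
      ring
    simp only [F, c, e, wrightTerm, limitKernelTerm]
    rw [Real.rpow_add ht0, Real.rpow_add ht0, Real.rpow_natCast, Real.rpow_mul ht0.le,
      Real.rpow_natCast, Real.mul_rpow hy.le ht0.le, Real.rpow_mul hy.le, Real.rpow_natCast,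
      neg_pow (x * t), neg_pow (y ^ θ * t ^ θ), mul_pow, mul_pow,
      show (α + 1) / θ + 1 / θ * k = (α + 1 + k) / θ by ring,
      show α + k + θ * l + 1 = α + 1 + k + θ * l by ring]
    field_simp
  have hsum := hasSum_integral_of_summable_integral_norm hint (by
    simp only [hnorm]
    exact (summable_abs_limitKernelTerm hα hθ hx hy).div_const θ)
  rw [setIntegral_congr_fun measurableSet_Ioc hF] at hsum
  simp only [hval] at hsum
  rw [intervalIntegral.integral_of_le zero_le_one, ← hsum.tsum_eq, tsum_div_const, limitKernel]
  field_simp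

end


/-! ### The rescaled kernel and the hard-edge limit -/

/-- The terms of the double series for the rescaled `N`-point kernel. -/
def scaledKernelTerm (α θ x y : ℝ) (N : ℕ) (p : ℕ × ℕ) : ℝ :=
  limitKernelTerm α θ x y p *
    (gammaRatio ((α + 1 + p.1) / θ) N * (((N - 1).descFactorial p.2 : ℝ) / (N : ℝ) ^ p.2))

/-- Restoring the omitted factor completes the Pochhammer product. That factor is `(α + 1 + s + θ l)
/ θ`, whose inverse is the coupling factor of the limit kernel. -/
theorem eval_nodePoly_mul_Gamma {α θ : ℝ} {N l : ℕ} (hl : l < N) (s : ℝ)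
    (hs : 0 < (α + 1 + s) / θ) :
    (nodePoly α θ N l).eval s * (((α + 1 + s) / θ + l) * Real.Gamma ((α + 1 + s) / θ)) =
      Real.Gamma ((α + 1 + s) / θ + N) := by
  rw [Gamma_add_natCast_eq_prod_mul hs, eval_nodePoly,
    ← Finset.prod_erase_mul _ _ (Finset.mem_range.mpr hl)]
  ring

section

variable {α θ : ℝ} (hα : -1 < α) (hθ : 0 < θ)
include hα hθ

theorem scaledKernelTerm_eq {N : ℕ} (l : Fin N) {x y : ℝ} (hx : 0 < x) (hy : 0 < y) (s : ℕ) :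
    x ^ α * scaledKernelTerm α θ x y N (s, l) =
      1 / (N : ℝ) ^ (1 / θ) * ((x / (N : ℝ) ^ (1 / θ)) ^ α * laguerreCoeff α θ N l *
        ((-(x / (N : ℝ) ^ (1 / θ))) ^ s / s.factorial * (nodePoly α θ N l).eval (s : ℝ))) *
        laguerreRight θ N l (y / (N : ℝ) ^ (1 / θ)) := by
  have hl := l.2
  have hα1 : 0 < α + 1 := by linarith
  have hN : (0 : ℝ) < N := by exact_mod_cast (show 0 < N by omega)
  have ha : 0 < (α + 1 + s) / θ := by positivity
  have hb : 0 < α + 1 + θ * (l : ℕ) := by positivity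
  have hM : 0 < (N : ℝ) ^ (1 / θ) := Real.rpow_pos_of_pos hN _
  have hMθ : ((N : ℝ) ^ (1 / θ)) ^ θ = N := by
    rw [← Real.rpow_mul hN.le, one_div_mul_cancel hθ.ne', Real.rpow_one]
  have hT : (N : ℝ) ^ ((α + 1 + s) / θ) =
      ((N : ℝ) ^ (1 / θ)) ^ α * (N : ℝ) ^ (1 / θ) * ((N : ℝ) ^ (1 / θ)) ^ s := by
    rw [← Real.rpow_natCast, ← Real.rpow_mul hN.le, ← Real.rpow_mul hN.le, ← Real.rpow_add hN,
      ← Real.rpow_add hN]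
    congr 1
    field_simp
  have hdesc : ((N - 1 - (l : ℕ)).factorial : ℝ) * (N - 1).descFactorial l =
      (N - 1).factorial := by
    exact_mod_cast Nat.factorial_mul_descFactorial (by omega)
  have hΓa := (Real.Gamma_pos_of_pos ha).ne'
  have hΓb := (Real.Gamma_pos_of_pos hb).ne'
  have hd : α + 1 + s + θ * (l : ℕ) ≠ 0 := by positivity
  have hal : (α + 1 + s) / θ + (l : ℕ) = (α + 1 + s + θ * (l : ℕ)) / θ := by field_simp
  have hMα : 0 < ((N : ℝ) ^ (1 / θ)) ^ α := Real.rpow_pos_of_pos hM _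
  have hf1 : ((N - 1 - (l : ℕ)).factorial : ℝ) ≠ 0 := by positivity
  have hf2 : ((N - 1).descFactorial l : ℝ) ≠ 0 := by
    intro h0
    rw [h0, mul_zero] at hdesc
    exact Nat.factorial_ne_zero (N - 1) (by exact_mod_cast hdesc.symm)
  simp only [scaledKernelTerm, limitKernelTerm, gammaRatio, laguerreCoeff, laguerreRight]
  rw [← eval_nodePoly_mul_Gamma hl _ ha, hT, ← hdesc, hal, Real.div_rpow hx.le hM.le,
    Real.div_rpow hy.le hM.le, hMθ, Real.rpow_mul hy.le, Real.rpow_natCast, neg_pow (x / _),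
    div_pow, div_pow]
  generalize (N : ℝ) ^ (1 / θ) = M at *
  field_simp

theorem hasSum_scaledKernelTerm {N : ℕ} (l : Fin N) {x y : ℝ} (hx : 0 < x) (hy : 0 < y) :
    HasSum (fun s : ℕ => x ^ α * scaledKernelTerm α θ x y N (s, l))
      (1 / (N : ℝ) ^ (1 / θ) * laguerreLeft α θ N l (x / (N : ℝ) ^ (1 / θ)) *
        laguerreRight θ N l (y / (N : ℝ) ^ (1 / θ))) := by
  set X := x / (N : ℝ) ^ (1 / θ) with hX
  have h := (((hasSum_companionCoeff α θ N l X).mul_left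
    (X ^ α * laguerreCoeff α θ N l)).mul_left (1 / (N : ℝ) ^ (1 / θ))).mul_right
    (laguerreRight θ N l (y / (N : ℝ) ^ (1 / θ)))
  simp only [scaledKernelTerm_eq hα hθ l hx hy]
  have hleft : laguerreLeft α θ N l X = X ^ α * laguerreCoeff α θ N l *
      (Real.exp (-X) * ∑ k ∈ Finset.range N, companionCoeff α θ N l k * X ^ k) := by
    rw [laguerreLeft, Finset.sum_range, Finset.mul_sum, Finset.mul_sum, Finset.mul_sum]
    exact Finset.sum_congr rfl fun k _ => by ring
  rwa [hleft]

theorem abs_scaledKernelTerm_le {N : ℕ} (hN : 1 ≤ N) (x y : ℝ) (p : ℕ × ℕ) :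
    |scaledKernelTerm α θ x y N p| ≤
      |limitKernelTerm α θ x y p| * (1 + Real.Gamma ((α + 1 + p.1) / θ + 1)) := by
  have hα1 : 0 < α + 1 := by linarith
  have ha : 0 < (α + 1 + p.1) / θ := by positivity
  have hg := gammaRatio_nonneg ha N
  rw [scaledKernelTerm, abs_mul, abs_of_nonneg (by positivity : 0 ≤
    gammaRatio ((α + 1 + p.1) / θ) N * (((N - 1).descFactorial p.2 : ℝ) / (N : ℝ) ^ p.2))]
  refine mul_le_mul_of_nonneg_left ?_ (abs_nonneg _)
  exact (mul_le_of_le_one_right hg (descFactorial_div_pow_le_one _ _)).trans (gammaRatio_le ha hN)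

/-- The rescaled `N`-point kernel as a double series. -/
theorem finiteRankKernel_eq_tsum {N : ℕ} (hN : 1 ≤ N) {x y : ℝ} (hx : 0 < x) (hy : 0 < y) :
    1 / (N : ℝ) ^ (1 / θ) * finiteRankKernel (laguerreLeft α θ N) (laguerreRight θ N)
      (x / (N : ℝ) ^ (1 / θ)) (y / (N : ℝ) ^ (1 / θ)) =
        x ^ α * ∑' p, scaledKernelTerm α θ x y N p := by
  obtain ⟨b, hb, hle⟩ := exists_summable_limitKernelTerm_bound hα hθ hx hy
  have hs : Summable (scaledKernelTerm α θ x y N) :=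
    Summable.of_norm_bounded hb fun p => (abs_scaledKernelTerm_le hα hθ hN x y p).trans (hle p)
  -- The falling factorial of `N - 1` vanishes for `l ≥ N`, so the full series in `l` is the finite
  -- sum of the kernel.
  have hinner : ∀ s, ∑' l, scaledKernelTerm α θ x y N (s, l) =
      ∑ l : Fin N, scaledKernelTerm α θ x y N (s, l) := fun s => by
    rw [← Finset.sum_range fun l => scaledKernelTerm α θ x y N (s, l)]
    refine tsum_eq_sum fun l hl => ?_
    have h0 : (N - 1).descFactorial l = 0 := by
      rw [Nat.descFactorial_eq_zero_iff_lt]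
      simp at hl
      omega
    simp [scaledKernelTerm, h0]
  rw [hs.tsum_prod, ← tsum_mul_left]
  simp only [hinner, Finset.mul_sum, finiteRankKernel]
  rw [(hasSum_sum fun l _ => hasSum_scaledKernelTerm hα hθ l hx hy).tsum_eq]
  exact Finset.sum_congr rfl fun l _ => by ring

theorem tendsto_tsum_scaledKernelTerm {x y : ℝ} (hx : 0 < x) (hy : 0 < y) :
    Tendsto (fun N : ℕ => ∑' p, scaledKernelTerm α θ x y N p) atTop
      (𝓝 (limitKernel α θ x y)) := by
  obtain ⟨b, hb, hle⟩ := exists_summable_limitKernelTerm_bound hα hθ hx hy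
  have hα1 : 0 < α + 1 := by linarith
  refine tendsto_tsum_of_dominated_convergence hb (fun p => ?_) ?_
  · have h := ((tendsto_gammaRatio (show 0 < (α + 1 + p.1) / θ by positivity)).mul
      (tendsto_descFactorial_div_pow p.2)).const_mul (limitKernelTerm α θ x y p)
    simpa only [scaledKernelTerm, mul_one] using h
  · filter_upwards [eventually_ge_atTop 1] with N hN p
    exact (abs_scaledKernelTerm_le hα hθ hN x y p).trans (hle p)

/-- The prefactor gives one `N ^ (-1 / θ)` to each of the `n` rows, and row `i` releases a factor `x
i ^ α`. -/
theorem scaled_laguerreCorrelation_eq {n N : ℕ} (hn : 1 ≤ n) (hnN : n ≤ N) {x : Fin n → ℝ}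
    (hx : ∀ i, 0 < x i) :
    1 / (N : ℝ) ^ ((n : ℝ) / θ) *
        laguerreCorrelation α θ n N (fun i => x i / (N : ℝ) ^ (1 / θ)) =
      (∏ i, x i ^ α) *
        (Matrix.of fun i j => ∑' p, scaledKernelTerm α θ (x i) (x j) N p).det := by
  have hpow : 1 / (N : ℝ) ^ ((n : ℝ) / θ) = (1 / (N : ℝ) ^ (1 / θ)) ^ Fintype.card (Fin n) := by
    rw [Fintype.card_fin, div_pow, one_pow, ← Real.rpow_natCast, ← Real.rpow_mul (by positivity),
      one_div_mul_eq_div]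
  rw [laguerreCorrelation_eq_kernelDet hα hθ hnN, kernelDet, hpow, ← Matrix.det_smul,
    ← Matrix.det_mul_column]
  congr 1
  ext i j
  simp only [Matrix.smul_apply, Matrix.of_apply, smul_eq_mul]
  exact finiteRankKernel_eq_tsum hα hθ (hn.trans hnN) (hx i) (hx j)

theorem tendsto_scaled_laguerreCorrelation {n : ℕ} (hn : 1 ≤ n) {x : Fin n → ℝ}
    (hx : ∀ i, 0 < x i) :
    Tendsto (fun N : ℕ => 1 / (N : ℝ) ^ ((n : ℝ) / θ) *
        laguerreCorrelation α θ n N (fun i => x i / (N : ℝ) ^ (1 / θ))) atTop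
      (𝓝 ((∏ i, x i ^ α) *
        (Matrix.of fun i j : Fin n => limitKernel α θ (x i) (x j)).det)) := by
  have h : Tendsto (fun N : ℕ => (∏ i, x i ^ α) *
      (Matrix.of fun i j => ∑' p, scaledKernelTerm α θ (x i) (x j) N p).det) atTop
      (𝓝 ((∏ i, x i ^ α) *
        (Matrix.of fun i j : Fin n => limitKernel α θ (x i) (x j)).det)) := by
    refine Tendsto.const_mul _ (((continuous_id.matrix_det).tendsto _).comp ?_)
    exact tendsto_pi_nhds.mpr fun i => tendsto_pi_nhds.mpr fun j =>
      tendsto_tsum_scaledKernelTerm hα hθ (hx i) (hx j)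
  refine h.congr' ?_
  filter_upwards [eventually_ge_atTop n] with N hN
  exact (scaled_laguerreCorrelation_eq hα hθ hn hN hx).symm

end

end

/-- Hard-edge scaling limit of the correlation functions of the biorthogonal Laguerre ensemble.
The first clause says that the ensemble and its correlation functions are well defined (the
normalisation integral and the integrals in the correlation functions converge), the second that
the limit kernel is well defined and has its integral representation, the third is the limit. -/
theorem theorem4p5 (α θ : ℝ) (hα : -1 < α) (hθ : 0 < θ) :
    (∀ N : ℕ,
      IntegrableOn (laguerreWeight α θ N) (posOrthant N) ∧ 0 < laguerreZ α θ N ∧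
      ∀ n : ℕ, 1 ≤ n → n ≤ N → ∀ x ∈ posOrthant n,
        IntegrableOn (fun y => laguerreDensity α θ N (joinPoints x y)) (posOrthant (N - n))) ∧
    (∀ s : ℝ, Summable (wrightTerm ((α + 1) / θ) (1 / θ) s) ∧
      Summable (wrightTerm (α + 1) θ s)) ∧
    (∀ x y : ℝ, 0 < x → 0 < y →
      Summable (limitKernelTerm α θ x y) ∧
      IntervalIntegrable (wrightIntegrand α θ x y) volume 0 1 ∧
      limitKernel α θ x y = θ * ∫ t in (0 : ℝ)..1, wrightIntegrand α θ x y t) ∧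
    (∀ n : ℕ, 1 ≤ n → ∀ x ∈ posOrthant n,
      Tendsto
        (fun N : ℕ => 1 / (N : ℝ) ^ ((n : ℝ) / θ) *
          laguerreCorrelation α θ n N (fun i => x i / (N : ℝ) ^ (1 / θ)))
        atTop
        (𝓝 ((∏ i, x i ^ α) *
          (Matrix.of fun i j : Fin n => limitKernel α θ (x i) (x j)).det))) := by
  have hα1 : 0 < α + 1 := by linarith
  refine ⟨fun N => ⟨?_, laguerreZ_pos hα hθ N, fun n _ hn x _ => ?_⟩, fun s => ⟨?_, ?_⟩,
    fun x y hx hy => ⟨?_, intervalIntegrable_wrightIntegrand hα hθ x y,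
      limitKernel_eq_integral hα hθ hx hy⟩, fun n hn x hx => ?_⟩
  · have hj : ∀ y : Fin N → ℝ, (joinPoints (Fin.elim0 : Fin 0 → ℝ) y : Fin N → ℝ) = y :=
      fun y => by
        ext i
        simp [joinPoints]
    have h := integrableOn_laguerreWeight_joinPoints hα hθ (Nat.zero_le N) Fin.elim0
    simpa only [Nat.sub_zero, hj] using h
  · exact (integrableOn_laguerreWeight_joinPoints hα hθ hn x).const_mul _
  · exact (summable_abs_wrightTerm (div_pos hα1 hθ) (one_div_pos.mpr hθ) s).of_abs
  · exact (summable_abs_wrightTerm hα1 hθ s).of_abs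
  · exact (summable_abs_limitKernelTerm hα hθ hx hy).of_abs
  · exact tendsto_scaled_laguerreCorrelation hα hθ hn fun i => hx i trivial
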